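/- Let $n\ge 2$ and let $X$ be a random vector in $\mathbb R^n$ with a radially symmetric probability density $f_\infty(|x|)$ with respect to Lebesgue measure. Put $f(\rho)=\sigma_n\rho^{n-1}f_\infty(\rho)$ for $\rho>0$, where $\sigma_n=2\pi^{n/2}/\Gamma(n/2)$, and let $w\ge 0$ be a Borel measurable function on $(0,\infty)$. Suppose that $f$ satisfies the one-dimensional Poincaré inequality on $(0,\infty)$ with weight $w$, that is, for every bounded $C^\infty$ function $\psi:(0,\infty)\to\mathbb R$, $$\int_0^\infty\Big(\psi(\rho)-\int_0^\infty\psi(s)f(s)\,ds\Big)^2f(\rho)\,d\rho\;\le\;\int_0^\infty w(\rho)\,|\psi'(\rho)|^2 f(\rho)\,d\rho ,$$ where the right-hand side may be $+\infty$. Then, for every $C^\infty$ function $\phi:\mathbb R^n\to\mathbb R$ such that $\phi(X)$ has finite variance, i.e. $\int_{\mathbb R^n}\phi^2(x)f_\infty(|x|)\,dx<\infty$, $$\int_{\mathbb R^n}\phi^2(x)f_\infty(|x|)\,dx-\Big(\int_{\mathbb R^n}\phi(y)f_\infty(|y|)\,dy\Big)^2\;\le\;\int_{\mathbb R^n}W_*(|x|)\,|\nabla\phi(x)|^2f_\infty(|x|)\,dx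 ,$$ where $W_*(r)=\max\{w(r),\tfrac{\pi^2}{2}r^2\}$ and the right-hand side may again be $+\infty$. -/

import Mathlib

open MeasureTheory
open scoped ContDiff

/-- The surface measure `σ_n = 2 π^{n/2} / Γ(n/2)` of the unit sphere of `ℝⁿ`. -/
noncomputable def sphereArea (n : ℕ) : ℝ :=
  2 * Real.pi ^ ((n : ℝ) / 2) / Real.Gamma ((n : ℝ) / 2)

/-- `finf` is the profile of a radially symmetric probability density `x ↦ finf |x|` on `ℝⁿ`
with respect to Lebesgue measure. (The values of `finf` on negative numbers play no role.) -/
structure IsRadialProbabilityDensity (n : ℕ) (finf : ℝ → ℝ) : Prop where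
  measurable : Measurable finf
  nonneg : ∀ r : ℝ, 0 ≤ r → 0 ≤ finf r
  integral_eq_one : ∫ x : EuclideanSpace ℝ (Fin n), finf ‖x‖ = 1

/-- The one-dimensional density `f(ρ) = σ_n ρ^{n-1} finf(ρ)` of `|X|`. -/
noncomputable def radialDensity (n : ℕ) (finf : ℝ → ℝ) (ρ : ℝ) : ℝ :=
  sphereArea n * ρ ^ (n - 1) * finf ρ

/-- A random variable with probability density `f` on the open set `I ⊆ ℝ` satisfies the
Poincaré inequality with weight `w`: for every bounded smooth `ψ` on `I`,
`Var[ψ(X)] ≤ E[w(X) |ψ'(X)|²]`. The right-hand side is a `[0,∞]`-valued integral, so that the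
inequality carries information only when this side is finite. -/
def SatisfiesPoincare (I : Set ℝ) (f w : ℝ → ℝ) : Prop :=
  ∀ ψ : ℝ → ℝ, ContDiffOn ℝ ∞ ψ I → (∃ C : ℝ, ∀ ρ ∈ I, |ψ ρ| ≤ C) →
    ENNReal.ofReal (∫ ρ in I, (ψ ρ - ∫ s in I, ψ s * f s) ^ 2 * f ρ)
      ≤ ∫⁻ ρ in I, ENNReal.ofReal (w ρ * |deriv ψ ρ| ^ 2 * f ρ)

/-- The weight `W_*(r) = max {w(r), (π²/2) r²}`. -/
noncomputable def maxWeight (w : ℝ → ℝ) (r : ℝ) : ℝ :=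
  max (w r) (Real.pi ^ 2 / 2 * r ^ 2)

/-!
A random vector with a radial density is `R θ` with `R = ‖X‖` independent of the uniform direction
`θ`, so the variance of `φ(X)` is the mean of the variance of `φ` on the sphere of radius `R` plus
the variance of `ψ(R)`, where `ψ` is the spherical mean of `φ`.

The uniform measure on spheres is realised by Haar probability on the orthogonal group `G`: the mean
over the sphere through `x` is the integral of `φ (g x)` over `g`, and by right invariance it depends
on `‖x‖` only (`IsTransitiveOnSpheres.integral_apply_eq`). Lebesgue measure with a radial density is
invariant under each `g`, hence under averaging (`IsTransitiveOnSpheres.measurePreserving_prod`), so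
no integration in polar coordinates is needed beyond the law of `‖X‖`
(`IsRadialProbabilityDensity.map_norm_radialMeasure`).

For the spherical part, the variance is half the mean of `(φ (g x) - φ (g h x)) ^ 2` over `g` and
`h`. For fixed `h`, join `x` to `h x` by an arc of a great circle, of angle at most `π`; the image
under a uniform `g` of any point of the arc is uniform on the sphere, so that Cauchy–Schwarz along
the arc bounds the mean over `g` by `π ^ 2 ‖x‖ ^ 2` times the mean squared tangential gradient
(`integral_sq_sub_le`, `variance_orbit_le`). For the radial part, `ψ` is smooth, `ψ' ^ 2` is at most
the mean squared radial derivative (`IsTransitiveOnSpheres.sq_deriv_sphericalMean_le`), and the one-dimensional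
inequality, extended from bounded functions by truncation (`SatisfiesPoincare.variance_le`), applies to `ψ`.
Both weights are at most `maxWeight w`, and the squared tangential and radial derivatives add up to
`‖∇φ‖ ^ 2` (`variance_orbit_add_deriv_le`).
-/

open scoped RealInnerProductSpace

/-! ### Great circles and averages -/

section GreatCircle

variable {E : Type*} [NormedAddCommGroup E] [InnerProductSpace ℝ E]

/-- Any two points of a sphere are joined by an arc of a great circle of angle `α ≤ π`; the vector
`v` is the initial direction, scaled to the radius of the sphere. -/
theorem exists_great_circle_through [FiniteDimensional ℝ E] (hE : 2 ≤ Module.finrank ℝ E)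
    {x y : E} (hxy : ‖x‖ = ‖y‖) :
    ∃ (v : E) (α : ℝ), ⟪x, v⟫ = 0 ∧ ‖v‖ = ‖x‖ ∧ 0 ≤ α ∧ α ≤ Real.pi ∧
      Real.cos α • x + Real.sin α • v = y := by
  rcases eq_or_ne x 0 with rfl | hx
  · have hy : y = 0 := by simpa using hxy.symm
    exact ⟨0, 0, by simp, by simp, le_rfl, Real.pi_pos.le, by simp [hy]⟩
  have hx0 : 0 < ‖x‖ := norm_pos_iff.2 hx
  have hxx : ⟪x, x⟫ = ‖x‖ ^ 2 := real_inner_self_eq_norm_sq x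
  have hyy : ⟪y, y⟫ = ‖x‖ ^ 2 := by rw [hxy]; exact real_inner_self_eq_norm_sq y
  set a : ℝ := ⟪x, y⟫ / ‖x‖ ^ 2 with ha
  have haxy : ⟪x, y⟫ = a * ‖x‖ ^ 2 := by rw [ha]; field_simp
  set z : E := y - a • x with hz
  have hxz : ⟪x, z⟫ = 0 := by
    rw [hz, inner_sub_right, inner_smul_right, hxx, haxy]; ring
  have hzz : ‖z‖ ^ 2 = (1 - a ^ 2) * ‖x‖ ^ 2 := by
    rw [← real_inner_self_eq_norm_sq, hz]
    simp only [inner_sub_left, inner_sub_right, inner_smul_left, inner_smul_right, hxx, hyy,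
      real_inner_comm x y, haxy, RCLike.conj_to_real]
    ring
  have hasq : a ^ 2 ≤ 1 := by
    by_contra! h
    nlinarith [sq_nonneg ‖z‖, pow_pos hx0 2]
  have hal : -1 ≤ a := (abs_le_one_iff_mul_self_le_one.2 (by nlinarith) |> abs_le.1).1
  have hau : a ≤ 1 := (abs_le_one_iff_mul_self_le_one.2 (by nlinarith) |> abs_le.1).2
  have hcos : Real.cos (Real.arccos a) = a := Real.cos_arccos hal hau
  have hsin : Real.sin (Real.arccos a) = √(1 - a ^ 2) := Real.sin_arccos a
  rcases eq_or_ne z 0 with hz0 | hz0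
  · -- `y = ± x`: any vector orthogonal to `x` serves, and one exists in dimension at least two.
    have h1 : 1 - a ^ 2 = 0 := by
      rw [hz0, norm_zero] at hzz
      have : (1 - a ^ 2) * ‖x‖ ^ 2 = 0 := by rw [← hzz]; ring
      rcases mul_eq_zero.1 this with h | h
      · exact h
      · exact absurd h (by positivity)
    obtain ⟨u, hu, hu0⟩ : ∃ u ∈ (ℝ ∙ x)ᗮ, u ≠ 0 := by
      apply Submodule.exists_mem_ne_zero_of_ne_bot
      intro hbot
      have h2 := Submodule.finrank_add_finrank_orthogonal (ℝ ∙ x)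
      rw [hbot, finrank_span_singleton hx, finrank_bot] at h2
      omega
    refine ⟨(‖x‖ / ‖u‖) • u, Real.arccos a, ?_, ?_, Real.arccos_nonneg a, Real.arccos_le_pi a, ?_⟩
    · rw [inner_smul_right, Submodule.mem_orthogonal_singleton_iff_inner_right.1 hu, mul_zero]
    · have : ‖u‖ ≠ 0 := norm_ne_zero_iff.2 hu0
      rw [norm_smul, Real.norm_of_nonneg (by positivity)]
      field_simp
    · rw [hcos, hsin, h1, Real.sqrt_zero, zero_smul, add_zero]
      exact (sub_eq_zero.1 hz0).symm
  · have hz0' : ‖z‖ ≠ 0 := norm_ne_zero_iff.2 hz0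
    refine ⟨(‖x‖ / ‖z‖) • z, Real.arccos a, ?_, ?_, Real.arccos_nonneg a, Real.arccos_le_pi a, ?_⟩
    · rw [inner_smul_right, hxz, mul_zero]
    · rw [norm_smul, Real.norm_of_nonneg (by positivity)]
      field_simp
    · have hs : √(1 - a ^ 2) * ‖x‖ = ‖z‖ := by
        rw [← Real.sqrt_sq (norm_nonneg z), hzz, Real.sqrt_mul (by linarith),
          Real.sqrt_sq hx0.le]
      rw [hcos, hsin, smul_smul, ← mul_div_assoc, hs, div_self hz0', one_smul, hz]
      abel

/-- The squared length of the component of `g` orthogonal to `z`, multiplied by `‖z‖ ^ 2`, bounds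
the squared pairing of `g` with any vector orthogonal to `z` and of the same length. -/
theorem sq_inner_le_of_inner_eq_zero {g z v : E} (hzv : ⟪z, v⟫ = 0) (hv : ‖v‖ = ‖z‖) :
    ⟪g, v⟫ ^ 2 ≤ ‖z‖ ^ 2 * ‖g‖ ^ 2 - ⟪g, z⟫ ^ 2 := by
  rcases eq_or_ne z 0 with rfl | hz
  · have : v = 0 := by simpa using hv
    simp [this]
  have hz0 : 0 < ‖z‖ := norm_pos_iff.2 hz
  have h := real_inner_self_nonneg (x := ‖z‖ ^ 2 • g - ⟪g, z⟫ • z - ⟪g, v⟫ • v)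
  have hzz : ⟪z, z⟫ = ‖z‖ ^ 2 := real_inner_self_eq_norm_sq z
  have hvv : ⟪v, v⟫ = ‖z‖ ^ 2 := by rw [← hv]; exact real_inner_self_eq_norm_sq v
  have hgg : ⟪g, g⟫ = ‖g‖ ^ 2 := real_inner_self_eq_norm_sq g
  have hvz : ⟪v, z⟫ = 0 := by rw [real_inner_comm]; exact hzv
  simp only [inner_sub_left, inner_sub_right, inner_smul_left, inner_smul_right, hzz, hvv, hgg,
    hzv, hvz, real_inner_comm g z, real_inner_comm g v, RCLike.conj_to_real] at h
  have h2 : 0 ≤ ‖z‖ ^ 2 * (‖z‖ ^ 2 * ‖g‖ ^ 2 - ⟪g, z⟫ ^ 2 - ⟪g, v⟫ ^ 2) := by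
    nlinarith [h]
  nlinarith [nonneg_of_mul_nonneg_right h2 (by positivity)]

end GreatCircle

section ProbabilityAverages

variable {Ω : Type*} [MeasurableSpace Ω] {P : Measure Ω} [IsProbabilityMeasure P] {f : Ω → ℝ}

theorem integral_quadratic (hf : Integrable f P) (hf2 : Integrable (fun t => f t ^ 2) P)
    (c d : ℝ) :
    ∫ t, (f t ^ 2 - c * f t + d) ∂P = ∫ t, f t ^ 2 ∂P - c * ∫ t, f t ∂P + d := by
  have h1 : Integrable (fun t => f t ^ 2 - c * f t) P := hf2.sub (hf.const_mul c)
  rw [integral_add h1 (integrable_const d), integral_sub hf2 (hf.const_mul c),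
    integral_const_mul]
  simp

theorem integral_sq_sub_const (hf : Integrable f P) (hf2 : Integrable (fun t => f t ^ 2) P)
    (c : ℝ) :
    ∫ t, (f t - c) ^ 2 ∂P = ∫ t, f t ^ 2 ∂P - 2 * c * ∫ t, f t ∂P + c ^ 2 := by
  rw [← integral_quadratic hf hf2]
  congr 1; ext t; ring

theorem sq_integral_le_integral_sq (hf : Integrable f P)
    (hf2 : Integrable (fun t => f t ^ 2) P) : (∫ t, f t ∂P) ^ 2 ≤ ∫ t, f t ^ 2 ∂P := by
  have h : 0 ≤ ∫ t, (f t - ∫ t', f t' ∂P) ^ 2 ∂P := integral_nonneg fun t => sq_nonneg _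
  rw [integral_sq_sub_const hf hf2] at h
  nlinarith

theorem integral_integral_sq_sub (hf : Integrable f P) (hf2 : Integrable (fun t => f t ^ 2) P) :
    ∫ t, ∫ t', (f t - f t') ^ 2 ∂P ∂P = 2 * (∫ t, f t ^ 2 ∂P - (∫ t, f t ∂P) ^ 2) := by
  have h1 : ∀ t, ∫ t', (f t - f t') ^ 2 ∂P
      = f t ^ 2 - (2 * ∫ t', f t' ∂P) * f t + ∫ t', f t' ^ 2 ∂P := by
    intro t
    simp_rw [fun t' => sub_sq_comm (f t) (f t')]
    rw [integral_sq_sub_const hf hf2]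
    ring
  simp_rw [h1]
  rw [integral_quadratic hf hf2]
  ring

end ProbabilityAverages

/-! ### The orthogonal group and its Haar measure -/

/-- An action of a compact second countable group `G` by linear isometries of `E`, jointly
continuous and transitive on every sphere centred at the origin. -/
structure IsTransitiveOnSpheres {E : Type*} [NormedAddCommGroup E] [InnerProductSpace ℝ E]
    {G : Type*} [Group G] [TopologicalSpace G] (ρ : G →* (E ≃ₗᵢ[ℝ] E)) : Prop where
  continuous : Continuous fun p : G × E => ρ p.1 p.2
  exists_apply_eq : ∀ x y : E, ‖x‖ = ‖y‖ → ∃ g, ρ g x = y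

universe u

section UnitaryGroup

variable (E : Type u) [NormedAddCommGroup E] [InnerProductSpace ℝ E] [FiniteDimensional ℝ E]

instance compactSpace_unitary : CompactSpace (unitary (E →L[ℝ] E)) := by
  apply isCompact_iff_compactSpace.1
  have : ProperSpace (E →L[ℝ] E) := FiniteDimensional.proper ℝ _
  refine Metric.isCompact_of_isClosed_isBounded isClosed_unitary ?_
  refine (Metric.isBounded_closedBall (x := (0 : E →L[ℝ] E)) (r := 1)).subset fun u hu => ?_
  rw [mem_closedBall_zero_iff]
  refine ContinuousLinearMap.opNorm_le_bound _ zero_le_one fun x => ?_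
  rw [one_mul]
  exact (Unitary.norm_map ⟨u, hu⟩ x).le

theorem isTransitiveOnSpheres_unitary :
    IsTransitiveOnSpheres
      (Unitary.linearIsometryEquiv (𝕜 := ℝ) (H := E)).toMonoidHom where
  continuous := by
    change Continuous fun p : unitary (E →L[ℝ] E) × E => (p.1 : E →L[ℝ] E) p.2
    fun_prop
  exists_apply_eq x y hxy := by
    refine ⟨Unitary.linearIsometryEquiv.symm (Submodule.reflection (ℝ ∙ (x - y))ᗮ), ?_⟩
    simpa using Submodule.reflection_sub hxy

/-- The orthogonal group of `E`, as an abstract compact group. Hiding the group behind an existential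
spares later arguments the instance search on `unitary (E →L[ℝ] E)` for a concrete space `E`. -/
theorem exists_isTransitiveOnSpheres : ∃ (G : Type u) (_ : Group G) (_ : TopologicalSpace G)
    (_ : IsTopologicalGroup G) (_ : CompactSpace G) (_ : T2Space G)
    (_ : SecondCountableTopology G) (_ : MeasurableSpace G) (_ : BorelSpace G)
    (ρ : G →* (E ≃ₗᵢ[ℝ] E)), IsTransitiveOnSpheres ρ := by
  have : SecondCountableTopology (E →L[ℝ] E) := by
    have : ProperSpace (E →L[ℝ] E) := FiniteDimensional.proper ℝ _
    infer_instance
  exact ⟨unitary (E →L[ℝ] E), inferInstance, inferInstance, inferInstance, inferInstance,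
    inferInstance, inferInstance, inferInstance, inferInstance, _,
    isTransitiveOnSpheres_unitary E⟩

end UnitaryGroup

/-- A compact group is unimodular: right translates of its Haar probability measure are again Haar
probability measures. -/
theorem exists_biinvariant_probabilityMeasure (G : Type*) [Group G] [TopologicalSpace G]
    [IsTopologicalGroup G] [CompactSpace G] [SecondCountableTopology G] [T2Space G]
    [MeasurableSpace G] [BorelSpace G] :
    ∃ P : Measure G, IsProbabilityMeasure P ∧ P.IsMulLeftInvariant ∧ P.IsMulRightInvariant := by
  let K : TopologicalSpace.PositiveCompacts G := ⊤
  let P : Measure G := Measure.haarMeasure K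
  have hP : IsProbabilityMeasure P := ⟨by
    have := Measure.haarMeasure_self (K₀ := K)
    simpa [K] using this⟩
  refine ⟨P, hP, inferInstance, ⟨fun g => ?_⟩⟩
  have : IsProbabilityMeasure (P.map (· * g)) :=
    Measure.isProbabilityMeasure_map (measurable_mul_const g).aemeasurable
  have : (P.map (· * g)).IsHaarMeasure := Measure.isHaarMeasure_map_mul_right P g
  exact Measure.isHaarMeasure_eq_of_isProbabilityMeasure _ _

theorem Continuous.integrable_of_compactSpace {X : Type*} [TopologicalSpace X] [CompactSpace X]
    [MeasurableSpace X] [OpensMeasurableSpace X] {P : Measure X} [IsFiniteMeasure P]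
    {f : X → ℝ} (hf : Continuous f) : Integrable f P :=
  hf.integrable_of_hasCompactSupport (HasCompactSupport.of_compactSpace f)

namespace IsTransitiveOnSpheres

variable {E : Type*} [NormedAddCommGroup E] [InnerProductSpace ℝ E]
  {G : Type*} [Group G] [TopologicalSpace G] {ρ : G →* (E ≃ₗᵢ[ℝ] E)}

theorem continuous_apply (hρ : IsTransitiveOnSpheres ρ) {ι : Type*} [TopologicalSpace ι]
    {u : ι → G} {x : ι → E} (hu : Continuous u) (hx : Continuous x) :
    Continuous fun i => ρ (u i) (x i) :=
  hρ.continuous.comp (hu.prodMk hx)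

/-- By right invariance, an average over `G` along an orbit depends on the sphere only. -/
theorem integral_apply_eq [MeasurableSpace G] [MeasurableMul G] {P : Measure G}
    [P.IsMulRightInvariant] (hρ : IsTransitiveOnSpheres ρ) {x y : E} (hxy : ‖x‖ = ‖y‖)
    (h : E → ℝ) : ∫ g, h (ρ g x) ∂P = ∫ g, h (ρ g y) ∂P := by
  obtain ⟨k, rfl⟩ := hρ.exists_apply_eq x y hxy
  have := integral_mul_right_eq_self (μ := P) (fun g => h (ρ g x)) k
  simpa using this.symm

end IsTransitiveOnSpheres

/-! ### The Poincaré inequality on spheres -/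

section SphericalPoincare

variable {E : Type*} [NormedAddCommGroup E] [InnerProductSpace ℝ E] [FiniteDimensional ℝ E]

/-- `‖z‖ ^ 2` times the squared norm of the component of `∇φ(z)` tangential to the sphere through
`z`. The factor makes this a continuous function also at the origin. -/
noncomputable def tangentialSq (φ : E → ℝ) (z : E) : ℝ :=
  ‖z‖ ^ 2 * ‖gradient φ z‖ ^ 2 - ⟪gradient φ z, z⟫ ^ 2

theorem continuous_gradient {φ : E → ℝ} (hφ : ContDiff ℝ ∞ φ) : Continuous (gradient φ) :=
  (InnerProductSpace.toDual ℝ E).symm.continuous.comp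
    (hφ.continuous_fderiv (by simp))

theorem continuous_tangentialSq {φ : E → ℝ} (hφ : ContDiff ℝ ∞ φ) :
    Continuous (tangentialSq φ) := by
  have := continuous_gradient hφ
  unfold tangentialSq
  fun_prop

theorem tangentialSq_nonneg (φ : E → ℝ) (z : E) : 0 ≤ tangentialSq φ z := by
  have h := abs_real_inner_le_norm (gradient φ z) z
  have := mul_self_le_mul_self (abs_nonneg _) h
  rw [abs_mul_abs_self] at this
  unfold tangentialSq
  nlinarith

variable {G : Type*} [Group G] [TopologicalSpace G] [MeasurableSpace G] [BorelSpace G]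
  [IsTopologicalGroup G] [CompactSpace G] [T2Space G] [SecondCountableTopology G]
  {ρ : G →* (E ≃ₗᵢ[ℝ] E)} {P : Measure G} [IsProbabilityMeasure P]

/-- Two points of a sphere are joined by a great circle arc of angle at most `π`; under the action
of `G` every point of the arc is distributed as its endpoints are, and the Cauchy–Schwarz
inequality along the arc gives the bound. -/
theorem integral_sq_sub_le [P.IsMulRightInvariant] (hρ : IsTransitiveOnSpheres ρ)
    (hE : 2 ≤ Module.finrank ℝ E) {φ : E → ℝ} (hφ : ContDiff ℝ ∞ φ) {x y : E}
    (hxy : ‖x‖ = ‖y‖) :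
    ∫ g, (φ (ρ g x) - φ (ρ g y)) ^ 2 ∂P
      ≤ Real.pi ^ 2 * ∫ g, tangentialSq φ (ρ g x) ∂P := by
  obtain ⟨v, α, hxv, hv, hα0, hαπ, rfl⟩ := exists_great_circle_through hE hxy
  let c : ℝ → E := fun t => Real.cos (α * t) • x + Real.sin (α * t) • v
  let c' : ℝ → E := fun t => -Real.sin (α * t) • x + Real.cos (α * t) • v
  have hc_cont : Continuous c := by fun_prop
  have hc'_cont : Continuous c' := by fun_prop
  have hvx : ⟪v, x⟫ = 0 := by rw [real_inner_comm]; exact hxv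
  have hxx : ⟪x, x⟫ = ‖x‖ ^ 2 := real_inner_self_eq_norm_sq x
  have hvv : ⟪v, v⟫ = ‖x‖ ^ 2 := by rw [← hv]; exact real_inner_self_eq_norm_sq v
  have hnorm : ∀ t, ‖c t‖ = ‖x‖ := fun t => by
    rw [← sq_eq_sq₀ (norm_nonneg _) (norm_nonneg _), ← real_inner_self_eq_norm_sq]
    simp only [c, inner_add_left, inner_add_right, inner_smul_left, inner_smul_right, hxx, hvv,
      hxv, hvx, RCLike.conj_to_real]
    linear_combination ‖x‖ ^ 2 * Real.sin_sq_add_cos_sq (α * t)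
  have hnorm' : ∀ t, ‖c' t‖ = ‖x‖ := fun t => by
    rw [← sq_eq_sq₀ (norm_nonneg _) (norm_nonneg _), ← real_inner_self_eq_norm_sq]
    simp only [c', inner_add_left, inner_add_right, inner_smul_left, inner_smul_right, hxx, hvv,
      hxv, hvx, RCLike.conj_to_real]
    linear_combination ‖x‖ ^ 2 * Real.sin_sq_add_cos_sq (α * t)
  have horth : ∀ t, ⟪c t, c' t⟫ = 0 := fun t => by
    simp only [c, c', inner_add_left, inner_add_right, inner_smul_left, inner_smul_right, hxx,
      hvv, hxv, hvx, RCLike.conj_to_real]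
    ring
  have hderiv : ∀ t, HasDerivAt c (α • c' t) t := fun t => by
    have h0 : HasDerivAt (fun t : ℝ => α * t) α t := by
      simpa using (hasDerivAt_id t).const_mul α
    have h1 := (h0.cos.smul_const x).add (h0.sin.smul_const v)
    refine h1.congr_deriv ?_
    simp only [c', smul_add, smul_smul]
    congr 2 <;> ring
  let Q : Measure ℝ := volume.restrict (Set.Icc 0 1)
  have hQ : IsProbabilityMeasure Q := ⟨by simp [Q]⟩
  have hQint : ∀ f : ℝ → ℝ, Continuous f → Integrable f Q := fun f hf =>
    hf.continuousOn.integrableOn_compact isCompact_Icc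
  have hgrad := continuous_gradient hφ
  have htan := continuous_tangentialSq hφ
  -- Cauchy–Schwarz along the image of the arc under `g`, whose velocity is tangential.
  have hpath : ∀ g, (φ (ρ g x) - φ (ρ g (Real.cos α • x + Real.sin α • v))) ^ 2
      ≤ ∫ t, α ^ 2 * tangentialSq φ (ρ g (c t)) ∂Q := by
    intro g
    let k : ℝ → ℝ := fun t => ⟪gradient φ (ρ g (c t)), ρ g (α • c' t)⟫
    have hk : Continuous k := by fun_prop
    have hd : ∀ t, HasDerivAt (fun t => φ (ρ g (c t))) (k t) t := fun t => by
      have h1 : HasDerivAt (fun t => ρ g (c t)) (ρ g (α • c' t)) t :=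
        ((ρ g).toContinuousLinearEquiv : E →L[ℝ] E).hasFDerivAt.comp_hasDerivAt t (hderiv t)
      have h2 := ((hφ.differentiable (by simp)) (ρ g (c t))).hasFDerivAt.comp_hasDerivAt t h1
      exact h2.congr_deriv (by simp [k])
    have hftc : ∫ t, k t ∂Q
        = φ (ρ g (Real.cos α • x + Real.sin α • v)) - φ (ρ g x) := by
      rw [integral_Icc_eq_integral_Ioc, ← intervalIntegral.integral_of_le zero_le_one,
        intervalIntegral.integral_eq_sub_of_hasDerivAt (fun t _ => hd t)
          (hk.intervalIntegrable 0 1)]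
      simp [c]
    rw [sub_sq_comm, ← hftc]
    refine (sq_integral_le_integral_sq (hQint _ hk) (hQint _ (hk.pow 2))).trans ?_
    refine integral_mono (hQint _ (hk.pow 2)) (hQint _ ?_) fun t => ?_
    · exact continuous_const.mul (htan.comp ((ρ g).continuous.comp hc_cont))
    · have h := sq_inner_le_of_inner_eq_zero (g := gradient φ (ρ g (c t)))
        (z := ρ g (c t)) (v := ρ g (c' t))
        (by rw [LinearIsometryEquiv.inner_map_map, horth])
        (by rw [LinearIsometryEquiv.norm_map, LinearIsometryEquiv.norm_map, hnorm, hnorm'])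
      simp only [k, map_smul, inner_smul_right, mul_pow]
      exact mul_le_mul_of_nonneg_left h (sq_nonneg α)
  have hjoint : Integrable (Function.uncurry fun (g : G) (t : ℝ) =>
      α ^ 2 * tangentialSq φ (ρ g (c t))) (P.prod Q) := by
    have hcont : Continuous (Function.uncurry fun (g : G) (t : ℝ) =>
        α ^ 2 * tangentialSq φ (ρ g (c t))) :=
      continuous_const.mul (htan.comp
        (hρ.continuous_apply continuous_fst (hc_cont.comp continuous_snd)))
    have h1 : P.prod Q = (P.prod volume).restrict (Set.univ ×ˢ Set.Icc 0 1) := by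
      rw [← Measure.prod_restrict, Measure.restrict_univ]
    rw [h1]
    exact hcont.continuousOn.integrableOn_compact (isCompact_univ.prod isCompact_Icc)
  have hdiff : Continuous fun g => (φ (ρ g x) - φ (ρ g (Real.cos α • x + Real.sin α • v))) ^ 2 :=
    ((hφ.continuous.comp (hρ.continuous_apply continuous_id continuous_const)).sub
      (hφ.continuous.comp (hρ.continuous_apply continuous_id continuous_const))).pow 2
  calc _ ≤ ∫ g, ∫ t, α ^ 2 * tangentialSq φ (ρ g (c t)) ∂Q ∂P :=
        integral_mono hdiff.integrable_of_compactSpace hjoint.integral_prod_left hpath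
    _ = ∫ t, ∫ g, α ^ 2 * tangentialSq φ (ρ g (c t)) ∂P ∂Q := integral_integral_swap hjoint
    _ = ∫ _t, α ^ 2 * ∫ g, tangentialSq φ (ρ g x) ∂P ∂Q := by
        congr 1; ext t
        rw [integral_const_mul, hρ.integral_apply_eq (hnorm t) (tangentialSq φ)]
    _ = α ^ 2 * ∫ g, tangentialSq φ (ρ g x) ∂P := by simp
    _ ≤ _ := mul_le_mul_of_nonneg_right (pow_le_pow_left₀ hα0 hαπ 2)
        (integral_nonneg fun g => tangentialSq_nonneg _ _)

/-- The Poincaré inequality on the sphere through `x`, with the constant `π ^ 2 / 2`. -/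
theorem variance_orbit_le [P.IsMulLeftInvariant] [P.IsMulRightInvariant]
    (hρ : IsTransitiveOnSpheres ρ)
    (hE : 2 ≤ Module.finrank ℝ E) {φ : E → ℝ} (hφ : ContDiff ℝ ∞ φ) (x : E) :
    ∫ g, φ (ρ g x) ^ 2 ∂P - (∫ g, φ (ρ g x) ∂P) ^ 2
      ≤ Real.pi ^ 2 / 2 * ∫ g, tangentialSq φ (ρ g x) ∂P := by
  have hc : Continuous fun g => φ (ρ g x) :=
    hφ.continuous.comp (hρ.continuous_apply continuous_id continuous_const)
  have hdouble := integral_integral_sq_sub (P := P) hc.integrable_of_compactSpace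
    (hc.pow 2).integrable_of_compactSpace
  have hjoint : Continuous (Function.uncurry fun g h : G =>
      (φ (ρ g x) - φ (ρ g (ρ h x))) ^ 2) := by
    refine (Continuous.sub ?_ ?_).pow 2
    · exact hφ.continuous.comp (hρ.continuous_apply continuous_fst continuous_const)
    · exact hφ.continuous.comp (hρ.continuous_apply continuous_fst
        (hρ.continuous_apply continuous_snd continuous_const))
  -- Left invariance replaces the second variable `h` by `g * h`, so that for fixed `h` the points
  -- `g x` and `g (h x)` are images of one fixed pair.
  have hshift : ∀ g, ∫ h, (φ (ρ g x) - φ (ρ h x)) ^ 2 ∂P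
      = ∫ h, (φ (ρ g x) - φ (ρ g (ρ h x))) ^ 2 ∂P := fun g => by
    rw [← integral_mul_left_eq_self _ g]
    simp
  simp_rw [hshift] at hdouble
  rw [integral_integral_swap hjoint.integrable_of_compactSpace] at hdouble
  have hle : ∫ h, ∫ g, (φ (ρ g x) - φ (ρ g (ρ h x))) ^ 2 ∂P ∂P
      ≤ ∫ _h : G, Real.pi ^ 2 * ∫ g, tangentialSq φ (ρ g x) ∂P ∂P := by
    refine integral_mono hjoint.integrable_of_compactSpace.integral_prod_right
      (integrable_const _) fun h => ?_
    exact integral_sq_sub_le hρ hE hφ (by simp)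
  rw [hdouble] at hle
  simp only [integral_const, probReal_univ, one_smul] at hle
  linarith

end SphericalPoincare

/-! ### Spherical means -/

section ParametricSmoothness

variable {E : Type*} [NormedAddCommGroup E] [NormedSpace ℝ E]
  {X : Type*} [TopologicalSpace X] [CompactSpace X] [MeasurableSpace X] [BorelSpace X]
  {P : Measure X} [IsFiniteMeasure P]

theorem hasDerivAt_integral_of_compactSpace {u : X → E} (hu : Continuous u) {F : ℝ × E → ℝ}
    (hF : ContDiff ℝ 1 F) (r : ℝ) :
    HasDerivAt (fun r => ∫ x, F (r, u x) ∂P) (∫ x, fderiv ℝ F (r, u x) (1, 0) ∂P) r := by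
  have hF' : Continuous fun p : ℝ × X => fderiv ℝ F (p.1, u p.2) (1, 0) := by
    have := hF.continuous_fderiv one_ne_zero
    fun_prop
  obtain ⟨C, hC⟩ := ((isCompact_closedBall r 1).prod
    (isCompact_univ (X := X))).exists_bound_of_continuousOn hF'.continuousOn
  refine (hasDerivAt_integral_of_dominated_loc_of_deriv_le (bound := fun _ => C)
    (Metric.closedBall_mem_nhds r one_pos) (.of_forall fun s => ?_) ?_ ?_
    (.of_forall fun x s hs => hC (s, x) ⟨hs, Set.mem_univ x⟩) (integrable_const C)
    (.of_forall fun x s _ => ?_)).2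
  · exact (hF.continuous.comp
      (by fun_prop : Continuous fun x => (s, u x))).integrable_of_compactSpace.1
  · exact (hF.continuous.comp
      (by fun_prop : Continuous fun x => (r, u x))).integrable_of_compactSpace
  · exact (hF'.comp (by fun_prop : Continuous fun x => (r, x))).integrable_of_compactSpace.1
  · exact ((hF.differentiable one_ne_zero) (s, u x)).hasFDerivAt.comp_hasDerivAt s
      ((hasDerivAt_id s).prodMk (hasDerivAt_const s (u x)))

theorem contDiff_integral_of_compactSpace {u : X → E} (hu : Continuous u) {F : ℝ × E → ℝ}
    (hF : ContDiff ℝ ∞ F) : ContDiff ℝ ∞ fun r => ∫ x, F (r, u x) ∂P := by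
  have hderiv : ∀ {F : ℝ × E → ℝ}, ContDiff ℝ ∞ F → ∀ r,
      HasDerivAt (fun r => ∫ x, F (r, u x) ∂P) (∫ x, fderiv ℝ F (r, u x) (1, 0) ∂P) r :=
    fun hF => hasDerivAt_integral_of_compactSpace hu (hF.of_le (by simp))
  rw [contDiff_infty]
  intro k
  induction k generalizing F with
  | zero =>
    exact contDiff_zero.2
      (Differentiable.continuous fun r => (hderiv hF r).differentiableAt)
  | succ k ih =>
    push_cast
    refine contDiff_succ_iff_deriv.2 ⟨fun r => (hderiv hF r).differentiableAt, by simp, ?_⟩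
    rw [funext fun r => (hderiv hF r).deriv]
    exact ih ((hF.fderiv_right (m := ∞) (by simp)).clm_apply contDiff_const)

end ParametricSmoothness

section SphericalMean

variable {E : Type*} [NormedAddCommGroup E] [InnerProductSpace ℝ E]
  {G : Type*} [Group G] [TopologicalSpace G] [MeasurableSpace G]

/-- The mean of `φ` over the orbit of `r • e`; when `ρ` is transitive on spheres and `e` has norm
one, this is the mean over the sphere of radius `|r|`. -/
noncomputable def sphericalMean (ρ : G →* (E ≃ₗᵢ[ℝ] E)) (P : Measure G) (e : E) (φ : E → ℝ)
    (r : ℝ) : ℝ :=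
  ∫ g, φ (r • ρ g e) ∂P

variable {ρ : G →* (E ≃ₗᵢ[ℝ] E)} {P : Measure G} {e : E} {φ : E → ℝ}

namespace IsTransitiveOnSpheres

theorem integral_apply_eq_sphericalMean [MeasurableMul G] [P.IsMulRightInvariant]
    (hρ : IsTransitiveOnSpheres ρ)
    (he : ‖e‖ = 1) (x : E) : ∫ g, φ (ρ g x) ∂P = sphericalMean ρ P e φ ‖x‖ := by
  simp_rw [sphericalMean, ← map_smul]
  exact hρ.integral_apply_eq (by simp [norm_smul, he]) φ

variable [BorelSpace G] [CompactSpace G] [IsProbabilityMeasure P]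

theorem contDiff_sphericalMean (hρ : IsTransitiveOnSpheres ρ) (hφ : ContDiff ℝ ∞ φ) :
    ContDiff ℝ ∞ (sphericalMean ρ P e φ) :=
  contDiff_integral_of_compactSpace (hρ.continuous_apply continuous_id continuous_const)
    (hφ.comp (contDiff_fst.smul contDiff_snd))

variable [FiniteDimensional ℝ E]

theorem deriv_sphericalMean (hρ : IsTransitiveOnSpheres ρ) (hφ : ContDiff ℝ ∞ φ) (r : ℝ) :
    deriv (sphericalMean ρ P e φ) r = ∫ g, ⟪gradient φ (r • ρ g e), ρ g e⟫ ∂P := by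
  have hF : ContDiff ℝ ∞ fun p : ℝ × E => φ (p.1 • p.2) :=
    hφ.comp (contDiff_fst.smul contDiff_snd)
  refine (hasDerivAt_integral_of_compactSpace
    (hρ.continuous_apply continuous_id continuous_const)
    (hF.of_le (by simp)) r).deriv.trans ?_
  congr 1; ext g
  have h1 : HasFDerivAt (fun p : ℝ × E => p.1 • p.2) _ (r, ρ g e) :=
    (ContinuousLinearMap.fst ℝ ℝ E).hasFDerivAt.smul (ContinuousLinearMap.snd ℝ ℝ E).hasFDerivAt
  have h2 := ((hφ.differentiable (by simp)) (r • ρ g e)).hasFDerivAt.comp (r, ρ g e) h1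
  change fderiv ℝ (φ ∘ fun p : ℝ × E => p.1 • p.2) (r, ρ g e) (1, 0) = _
  rw [h2.fderiv]
  simp

theorem sq_deriv_sphericalMean_le [MeasurableMul G] [P.IsMulRightInvariant]
    (hρ : IsTransitiveOnSpheres ρ)
    (hφ : ContDiff ℝ ∞ φ) (he : ‖e‖ = 1) {x : E} (hx : x ≠ 0) :
    deriv (sphericalMean ρ P e φ) ‖x‖ ^ 2
      ≤ ∫ g, ⟪gradient φ (ρ g x), ρ g x⟫ ^ 2 / ‖x‖ ^ 2 ∂P := by
  have hx0 : ‖x‖ ≠ 0 := norm_ne_zero_iff.2 hx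
  have hgrad := continuous_gradient hφ
  have hcont : Continuous fun g => ⟪gradient φ (ρ g x), ρ g x⟫ / ‖x‖ := by
    have := hρ.continuous_apply (u := fun g => g) continuous_id (continuous_const (y := x))
    fun_prop
  have h : deriv (sphericalMean ρ P e φ) ‖x‖
      = ∫ g, ⟪gradient φ (ρ g x), ρ g x⟫ / ‖x‖ ∂P := by
    rw [hρ.deriv_sphericalMean hφ,
      hρ.integral_apply_eq (x := x) (y := ‖x‖ • e) (by simp [norm_smul, he])
        (fun z => ⟪gradient φ z, z⟫ / ‖x‖)]
    congr 1; ext g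
    rw [map_smul, inner_smul_right]
    field_simp
  rw [h]
  simp_rw [← div_pow]
  exact sq_integral_le_integral_sq hcont.integrable_of_compactSpace
    (hcont.pow 2).integrable_of_compactSpace

end IsTransitiveOnSpheres

end SphericalMean

/-! ### The one-dimensional inequality -/

section OneDimensional

/-- The measure on `ℝ` with density `f` on `(0, ∞)`, negative values of `f` counting as zero. -/
noncomputable def halfLineMeasure (f : ℝ → ℝ) : Measure ℝ :=
  (volume.restrict (Set.Ioi 0)).withDensity fun r => ENNReal.ofReal (f r)

theorem integral_halfLineMeasure {f : ℝ → ℝ} (hf : Measurable f) (hf0 : ∀ r, 0 < r → 0 ≤ f r)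
    (u : ℝ → ℝ) : ∫ r, u r ∂halfLineMeasure f = ∫ r in Set.Ioi 0, u r * f r := by
  rw [halfLineMeasure, integral_withDensity_eq_integral_toReal_smul
    hf.ennreal_ofReal (.of_forall fun _ => ENNReal.ofReal_lt_top)]
  refine setIntegral_congr_fun measurableSet_Ioi fun r hr => ?_
  simp [ENNReal.toReal_ofReal (hf0 r hr), mul_comm]

/-- The one-dimensional Poincaré inequality extends from bounded functions to all smooth functions
with finite second moment: apply it to the truncations `k sin(ψ / k)`, whose derivatives
are at most `|ψ'|` in absolute value. -/
theorem SatisfiesPoincare.variance_le {f w : ℝ → ℝ} (hP : SatisfiesPoincare (Set.Ioi 0) f w)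
    (hf : Measurable f) (hf0 : ∀ r, 0 < r → 0 ≤ f r) (hw : Measurable w)
    (hw0 : ∀ r, 0 < r → 0 ≤ w r)
    [IsProbabilityMeasure (halfLineMeasure f)] {ψ : ℝ → ℝ} (hψ : ContDiff ℝ ∞ ψ)
    (hψ2 : Integrable (fun r => ψ r ^ 2) (halfLineMeasure f)) :
    ENNReal.ofReal (∫ r, ψ r ^ 2 ∂halfLineMeasure f - (∫ r, ψ r ∂halfLineMeasure f) ^ 2)
      ≤ ∫⁻ r, ENNReal.ofReal (w r * deriv ψ r ^ 2) ∂halfLineMeasure f := by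
  set ν := halfLineMeasure f with hν
  let T : ℕ → ℝ → ℝ := fun k r => (k + 1 : ℝ) * Real.sin (ψ r / (k + 1))
  have hTc : ∀ k, Continuous (T k) := fun k => by
    have := hψ.continuous
    fun_prop
  have hk : ∀ k : ℕ, (0 : ℝ) < k + 1 := fun k => by positivity
  have hTabs : ∀ k r, |T k r| ≤ |ψ r| := fun k r => by
    have h := Real.abs_sin_le_abs (x := ψ r / (k + 1))
    rw [abs_div, abs_of_pos (hk k), le_div_iff₀ (hk k)] at h
    simp only [T, abs_mul, abs_of_pos (hk k)]
    linarith
  have hTsq : ∀ k r, T k r ^ 2 ≤ ψ r ^ 2 := fun k r => sq_le_sq.2 (hTabs k r)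
  have hTbound : ∀ k r, |T k r| ≤ k + 1 := fun k r => by
    simp only [T, abs_mul, abs_of_pos (hk k)]
    exact mul_le_of_le_one_right (hk k).le (Real.abs_sin_le_one _)
  have hTsmooth : ∀ k, ContDiff ℝ ∞ (T k) := fun k =>
    contDiff_const.mul (hψ.div_const _).sin
  have hTderiv : ∀ k r, deriv (T k) r ^ 2 ≤ deriv ψ r ^ 2 := fun k r => by
    have h : HasDerivAt (T k) (Real.cos (ψ r / (k + 1)) * deriv ψ r) r := by
      have h1 := ((((hψ.differentiable (by simp)) r).hasDerivAt.div_const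
        ((k : ℝ) + 1)).sin).const_mul ((k : ℝ) + 1)
      refine h1.congr_deriv ?_
      have := (hk k).ne'
      field_simp
    rw [h.deriv, mul_pow]
    exact mul_le_of_le_one_left (sq_nonneg _) (Real.cos_sq_le_one _)
  have hTlim : ∀ r, Filter.Tendsto (fun k => T k r) Filter.atTop (nhds (ψ r)) := fun r => by
    -- `k sin(a / k)` is `a sinc(a / k)`.
    have h0 : Filter.Tendsto (fun k : ℕ => ψ r / ((k : ℝ) + 1)) Filter.atTop (nhds 0) :=
      tendsto_const_nhds.div_atTop
        (Filter.tendsto_atTop_add_const_right _ _ tendsto_natCast_atTop_atTop)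
    have h1 : Filter.Tendsto (fun k : ℕ => ψ r * Real.sinc (ψ r / ((k : ℝ) + 1)))
        Filter.atTop (nhds (ψ r * Real.sinc 0)) :=
      ((Real.continuous_sinc.tendsto 0).comp h0).const_mul _
    rw [Real.sinc_zero, mul_one] at h1
    refine h1.congr fun k => ?_
    have hk' := (hk k).ne'
    rcases eq_or_ne (ψ r) 0 with h | h
    · simp [T, h]
    · rw [Real.sinc_of_ne_zero (div_ne_zero h hk')]
      simp only [T]
      field_simp
  have hψ1 : Integrable ψ ν := by
    have h := (memLp_two_iff_integrable_sq hψ.continuous.aestronglyMeasurable).2 hψ2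
    exact h.integrable one_le_two
  have hT1 : ∀ k, Integrable (T k) ν := fun k =>
    hψ1.mono (hTc k).aestronglyMeasurable (.of_forall (hTabs k))
  have hT2 : ∀ k, Integrable (fun r => T k r ^ 2) ν := fun k =>
    hψ2.mono ((hTc k).pow 2).aestronglyMeasurable (.of_forall fun r => by
      simpa using hTsq k r)
  have hlim1 : Filter.Tendsto (fun k => ∫ r, T k r ∂ν) Filter.atTop (nhds (∫ r, ψ r ∂ν)) :=
    tendsto_integral_of_dominated_convergence (fun r => |ψ r|)
      (fun k => (hTc k).aestronglyMeasurable) hψ1.abs (fun k => .of_forall (hTabs k))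
      (.of_forall hTlim)
  have hlim2 : Filter.Tendsto (fun k => ∫ r, T k r ^ 2 ∂ν) Filter.atTop
      (nhds (∫ r, ψ r ^ 2 ∂ν)) :=
    tendsto_integral_of_dominated_convergence (fun r => ψ r ^ 2)
      (fun k => ((hTc k).pow 2).aestronglyMeasurable) hψ2
      (fun k => .of_forall fun r => by simpa using hTsq k r)
      (.of_forall fun r => (hTlim r).pow 2)
  refine le_of_tendsto' ((ENNReal.continuous_ofReal.tendsto _).comp
    (hlim2.sub (hlim1.pow 2))) fun k => ?_
  have hvar : ∫ r, T k r ^ 2 ∂ν - (∫ r, T k r ∂ν) ^ 2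
      = ∫ r in Set.Ioi 0, (T k r - ∫ s in Set.Ioi 0, T k s * f s) ^ 2 * f r := by
    rw [← integral_halfLineMeasure hf hf0, ← integral_halfLineMeasure hf hf0,
      integral_sq_sub_const (hT1 k) (hT2 k)]
    ring
  refine ((congrArg ENNReal.ofReal hvar).le.trans (hP (T k) (hTsmooth k).contDiffOn
    ⟨k + 1, fun r _ => hTbound k r⟩)).trans ?_
  have hmeas : Measurable fun r => ENNReal.ofReal (w r * deriv ψ r ^ 2) :=
    (hw.mul ((measurable_deriv ψ).pow_const 2)).ennreal_ofReal
  rw [hν, halfLineMeasure, lintegral_withDensity_eq_lintegral_mul _ hf.ennreal_ofReal hmeas]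
  refine setLIntegral_mono (hf.ennreal_ofReal.mul hmeas) fun r hr => ?_
  rw [Pi.mul_apply, ← ENNReal.ofReal_mul (hf0 r hr), mul_comm (f r), sq_abs]
  refine ENNReal.ofReal_le_ofReal (mul_le_mul_of_nonneg_right ?_ (hf0 r hr))
  exact mul_le_mul_of_nonneg_left (hTderiv k r) (hw0 r hr)

end OneDimensional

/-! ### Measures with radial density -/

section RadialMeasure

/-- The measure on `E` with radial density `finf ‖x‖` with respect to Lebesgue measure. -/
noncomputable def radialMeasure (E : Type*) [NormedAddCommGroup E] [MeasureSpace E]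
    (finf : ℝ → ℝ) : Measure E :=
  volume.withDensity fun x => ENNReal.ofReal (finf ‖x‖)

theorem measurable_ofReal_comp_norm {E : Type*} [NormedAddCommGroup E] [MeasurableSpace E]
    [OpensMeasurableSpace E] {finf : ℝ → ℝ} (hf : Measurable finf) :
    Measurable fun x : E => ENNReal.ofReal (finf ‖x‖) :=
  (hf.comp measurable_norm).ennreal_ofReal

section Invariance

variable {E : Type*} [NormedAddCommGroup E] [InnerProductSpace ℝ E] [FiniteDimensional ℝ E]
  [MeasurableSpace E] [BorelSpace E] {finf : ℝ → ℝ}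

instance : SFinite (radialMeasure E finf) := by unfold radialMeasure; infer_instance

theorem measurePreserving_radialMeasure (hf : Measurable finf) (T : E ≃ₗᵢ[ℝ] E) :
    MeasurePreserving T (radialMeasure E finf) (radialMeasure E finf) := by
  refine ⟨T.continuous.measurable, Measure.ext fun s hs => ?_⟩
  rw [Measure.map_apply T.continuous.measurable hs, radialMeasure, withDensity_apply _ hs,
    withDensity_apply _ (T.continuous.measurable hs),
    ← T.measurePreserving.setLIntegral_comp_preimage hs
      (measurable_ofReal_comp_norm hf)]
  simp

theorem IsTransitiveOnSpheres.measurePreserving_prod {G : Type*} [Group G] [TopologicalSpace G]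
    [MeasurableSpace G] [BorelSpace G] [SecondCountableTopology G] {ρ : G →* (E ≃ₗᵢ[ℝ] E)}
    {P : Measure G} [IsProbabilityMeasure P] (hρ : IsTransitiveOnSpheres ρ)
    (hf : Measurable finf) :
    MeasurePreserving (fun p : E × G => ρ p.2 p.1) ((radialMeasure E finf).prod P)
      (radialMeasure E finf) := by
  have hm : Measurable fun p : E × G => ρ p.2 p.1 :=
    (hρ.continuous_apply continuous_snd continuous_fst).measurable
  refine ⟨hm, Measure.ext fun s hs => ?_⟩
  rw [Measure.map_apply hm hs, Measure.prod_apply_symm (hm hs)]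
  have h : ∀ g : G,
      radialMeasure E finf ((fun x => (x, g)) ⁻¹' ((fun p : E × G => ρ p.2 p.1) ⁻¹' s))
      = radialMeasure E finf s := fun g =>
    (measurePreserving_radialMeasure hf (ρ g)).measure_preimage hs.nullMeasurableSet
  simp [h]

end Invariance

section Norm

variable {n : ℕ} {finf : ℝ → ℝ}

theorem natCast_mul_volume_ball_eq_sphereArea (hn : n ≠ 0) :
    (n : ℝ) * (volume : Measure (EuclideanSpace ℝ (Fin n))).real (Metric.ball 0 1)
      = sphereArea n := by
  have : Nonempty (Fin n) := Fin.pos_iff_nonempty.1 (Nat.pos_of_ne_zero hn)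
  have hn0 : (0 : ℝ) < n := by exact_mod_cast Nat.pos_of_ne_zero hn
  have hΓ := Real.Gamma_pos_of_pos (half_pos hn0)
  rw [Measure.real, EuclideanSpace.volume_ball, Fintype.card_fin, ENNReal.ofReal_one, one_pow,
    one_mul, ENNReal.toReal_ofReal (by positivity), Real.Gamma_add_one (by positivity), sphereArea,
    Real.sqrt_eq_rpow, ← Real.rpow_natCast, ← Real.rpow_mul Real.pi_pos.le,
    one_div_mul_eq_div]
  field_simp

theorem sphereArea_nonneg (n : ℕ) : 0 ≤ sphereArea n :=
  div_nonneg (by positivity) (Real.Gamma_nonneg_of_nonneg (by positivity))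

namespace IsRadialProbabilityDensity

theorem measurable_radialDensity (hf : IsRadialProbabilityDensity n finf) :
    Measurable (radialDensity n finf) :=
  (measurable_const.mul (measurable_id.pow_const _)).mul hf.measurable

theorem radialDensity_nonneg (hf : IsRadialProbabilityDensity n finf) {r : ℝ} (hr : 0 < r) :
    0 ≤ radialDensity n finf r :=
  mul_nonneg (mul_nonneg (sphereArea_nonneg n) (by positivity)) (hf.nonneg r hr.le)

theorem integrable (hf : IsRadialProbabilityDensity n finf) :
    Integrable fun x : EuclideanSpace ℝ (Fin n) => finf ‖x‖ := by
  by_contra h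
  have := hf.integral_eq_one
  rw [integral_undef h] at this
  exact zero_ne_one this

theorem isProbabilityMeasure_radialMeasure (hf : IsRadialProbabilityDensity n finf) :
    IsProbabilityMeasure (radialMeasure (EuclideanSpace ℝ (Fin n)) finf) := ⟨by
  rw [radialMeasure, withDensity_apply _ .univ, Measure.restrict_univ,
    ← ofReal_integral_eq_lintegral_ofReal hf.integrable
      (.of_forall fun x => hf.nonneg _ (norm_nonneg x)), hf.integral_eq_one, ENNReal.ofReal_one]⟩

theorem integral_radialMeasure (hf : IsRadialProbabilityDensity n finf)
    (u : EuclideanSpace ℝ (Fin n) → ℝ) :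
    ∫ x, u x ∂radialMeasure _ finf = ∫ x, u x * finf ‖x‖ := by
  rw [radialMeasure, integral_withDensity_eq_integral_toReal_smul
    (measurable_ofReal_comp_norm hf.measurable)
    (.of_forall fun _ => ENNReal.ofReal_lt_top)]
  congr 1; ext x
  simp [ENNReal.toReal_ofReal (hf.nonneg _ (norm_nonneg x)), mul_comm]

theorem integrable_radialMeasure_iff (hf : IsRadialProbabilityDensity n finf)
    {u : EuclideanSpace ℝ (Fin n) → ℝ} :
    Integrable u (radialMeasure _ finf) ↔ Integrable fun x => u x * finf ‖x‖ := by
  rw [radialMeasure, integrable_withDensity_iff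
    (measurable_ofReal_comp_norm hf.measurable)
    (.of_forall fun _ => ENNReal.ofReal_lt_top)]
  simp [ENNReal.toReal_ofReal (hf.nonneg _ (norm_nonneg _))]

/-- The norm of a random vector with density `finf ‖x‖` has density `radialDensity n finf`. -/
theorem map_norm_radialMeasure (hf : IsRadialProbabilityDensity n finf) (hn : n ≠ 0) :
    (radialMeasure (EuclideanSpace ℝ (Fin n)) finf).map norm
      = halfLineMeasure (radialDensity n finf) := by
  have : Nontrivial (EuclideanSpace ℝ (Fin n)) := by
    apply Module.nontrivial_of_finrank_pos (R := ℝ)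
    simpa using Nat.pos_of_ne_zero hn
  have hprob := hf.isProbabilityMeasure_radialMeasure
  have hint : IntegrableOn (radialDensity n finf) (Set.Ioi 0) := by
    have h := (integrable_fun_norm_addHaar
      (volume : Measure (EuclideanSpace ℝ (Fin n)))).1 hf.integrable
    rw [finrank_euclideanSpace_fin] at h
    refine (h.const_mul (sphereArea n)).congr (.of_forall fun r => ?_)
    simp [radialDensity, mul_assoc]
  have hfin : IsFiniteMeasure (halfLineMeasure (radialDensity n finf)) :=
    isFiniteMeasure_withDensity_ofReal hint.2
  have hreal : ∀ s, MeasurableSet s →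
      ((radialMeasure (EuclideanSpace ℝ (Fin n)) finf).map norm).real s
        = (halfLineMeasure (radialDensity n finf)).real s := by
    intro s hs
    rw [← integral_indicator_one hs, ← integral_indicator_one hs,
      integral_map measurable_norm.aemeasurable
        (measurable_one.indicator hs).aestronglyMeasurable,
      hf.integral_radialMeasure,
      integral_halfLineMeasure hf.measurable_radialDensity fun r hr => hf.radialDensity_nonneg hr,
      integral_fun_norm_addHaar volume fun r => s.indicator 1 r * finf r,
      finrank_euclideanSpace_fin, nsmul_eq_mul, smul_eq_mul, ← mul_assoc,
      natCast_mul_volume_ball_eq_sphereArea hn, ← integral_const_mul]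
    congr 1; ext r
    simp only [radialDensity, smul_eq_mul]
    ring
  refine Measure.ext fun s hs => ?_
  have : IsFiniteMeasure ((radialMeasure (EuclideanSpace ℝ (Fin n)) finf).map norm) :=
    inferInstance
  exact (measureReal_eq_measureReal_iff).1 (hreal s hs)

end IsRadialProbabilityDensity

end Norm

end RadialMeasure

/-! ### Recombination of the radial and tangential parts -/

section Orbit

variable {E : Type*} [NormedAddCommGroup E] [InnerProductSpace ℝ E] [FiniteDimensional ℝ E]
  {G : Type*} [Group G] [TopologicalSpace G] [MeasurableSpace G] [BorelSpace G]
  [IsTopologicalGroup G] [CompactSpace G] [T2Space G] [SecondCountableTopology G]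
  {ρ : G →* (E ≃ₗᵢ[ℝ] E)} {P : Measure G} [IsProbabilityMeasure P]

/-- On the sphere through `x`, the variance of `φ` is paid for by the tangential part of the
gradient and the derivative of the spherical mean by its radial part; since `maxWeight w` dominates
both weights, Pythagoras recombines the two parts. -/
theorem variance_orbit_add_deriv_le [P.IsMulLeftInvariant] [P.IsMulRightInvariant]
    (hρ : IsTransitiveOnSpheres ρ)
    (hE : 2 ≤ Module.finrank ℝ E) {φ : E → ℝ} (hφ : ContDiff ℝ ∞ φ) {e : E} (he : ‖e‖ = 1)
    {w : ℝ → ℝ} (hw : ∀ r, 0 < r → 0 ≤ w r) {x : E} (hx : x ≠ 0) :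
    ENNReal.ofReal (∫ g, φ (ρ g x) ^ 2 ∂P - (∫ g, φ (ρ g x) ∂P) ^ 2)
        + ENNReal.ofReal (w ‖x‖ * deriv (sphericalMean ρ P e φ) ‖x‖ ^ 2)
      ≤ ∫⁻ g, ENNReal.ofReal (maxWeight w ‖ρ g x‖ * ‖gradient φ (ρ g x)‖ ^ 2) ∂P := by
  have hr : 0 < ‖x‖ := norm_pos_iff.2 hx
  have hw0 := hw _ hr
  have hW0 : 0 ≤ maxWeight w ‖x‖ := hw0.trans (le_max_left _ _)
  have hgrad := continuous_gradient hφ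
  have hcont := hρ.continuous_apply (u := fun g => g) continuous_id (continuous_const (y := x))
  have hN : Continuous fun g => maxWeight w ‖x‖ * ‖gradient φ (ρ g x)‖ ^ 2 := by fun_prop
  have hτ : Continuous fun g => tangentialSq φ (ρ g x) :=
    (continuous_tangentialSq hφ).comp hcont
  have hR : Continuous fun g => ⟪gradient φ (ρ g x), ρ g x⟫ ^ 2 / ‖x‖ ^ 2 := by fun_prop
  have hvar := variance_orbit_le (P := P) hρ hE hφ x
  have hder := hρ.sq_deriv_sphericalMean_le (P := P) hφ he hx
  have hvar0 : 0 ≤ ∫ g, φ (ρ g x) ^ 2 ∂P - (∫ g, φ (ρ g x) ∂P) ^ 2 :=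
    sub_nonneg.2 (sq_integral_le_integral_sq (hφ.continuous.comp hcont).integrable_of_compactSpace
      ((hφ.continuous.comp hcont).pow 2).integrable_of_compactSpace)
  simp_rw [LinearIsometryEquiv.norm_map]
  rw [← ofReal_integral_eq_lintegral_ofReal hN.integrable_of_compactSpace
      (.of_forall fun g => mul_nonneg hW0 (sq_nonneg _)),
    ← ENNReal.ofReal_add hvar0 (mul_nonneg hw0 (sq_nonneg _))]
  refine ENNReal.ofReal_le_ofReal ((add_le_add hvar
    (mul_le_mul_of_nonneg_left hder hw0)).trans ?_)
  rw [← integral_const_mul, ← integral_const_mul,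
    ← integral_add (hτ.integrable_of_compactSpace.const_mul _)
      (hR.integrable_of_compactSpace.const_mul _)]
  refine integral_mono ((hτ.integrable_of_compactSpace.const_mul _).add
      (hR.integrable_of_compactSpace.const_mul _)) hN.integrable_of_compactSpace fun g => ?_
  have hsplit : tangentialSq φ (ρ g x) = ‖x‖ ^ 2 * (‖gradient φ (ρ g x)‖ ^ 2
      - ⟪gradient φ (ρ g x), ρ g x⟫ ^ 2 / ‖x‖ ^ 2) := by
    rw [tangentialSq, LinearIsometryEquiv.norm_map]
    field_simp
  have hnn : 0 ≤ ‖gradient φ (ρ g x)‖ ^ 2 - ⟪gradient φ (ρ g x), ρ g x⟫ ^ 2 / ‖x‖ ^ 2 :=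
    nonneg_of_mul_nonneg_right (hsplit ▸ tangentialSq_nonneg φ (ρ g x)) (by positivity)
  have hRnn : 0 ≤ ⟪gradient φ (ρ g x), ρ g x⟫ ^ 2 / ‖x‖ ^ 2 := by positivity
  have h1 := mul_le_mul_of_nonneg_right
    (le_max_right (w ‖x‖) (Real.pi ^ 2 / 2 * ‖x‖ ^ 2)) hnn
  have h2 := mul_le_mul_of_nonneg_right
    (le_max_left (w ‖x‖) (Real.pi ^ 2 / 2 * ‖x‖ ^ 2)) hRnn
  simp only [hsplit, maxWeight]
  linarith

end Orbit

theorem theorem4p3 (n : ℕ) (hn : 2 ≤ n) (finf w : ℝ → ℝ)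
    (hf : IsRadialProbabilityDensity n finf)
    (hw_meas : Measurable w) (hw_nonneg : ∀ ρ : ℝ, 0 < ρ → 0 ≤ w ρ)
    (hP : SatisfiesPoincare (Set.Ioi 0) (radialDensity n finf) w)
    (φ : EuclideanSpace ℝ (Fin n) → ℝ) (hφ : ContDiff ℝ ∞ φ)
    (hvar : Integrable (fun x : EuclideanSpace ℝ (Fin n) => φ x ^ 2 * finf ‖x‖)) :
    ENNReal.ofReal ((∫ x : EuclideanSpace ℝ (Fin n), φ x ^ 2 * finf ‖x‖)
        - (∫ y : EuclideanSpace ℝ (Fin n), φ y * finf ‖y‖) ^ 2)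
      ≤ ∫⁻ x : EuclideanSpace ℝ (Fin n),
          ENNReal.ofReal (maxWeight w ‖x‖ * ‖gradient φ x‖ ^ 2 * finf ‖x‖) := by
  have hE : 2 ≤ Module.finrank ℝ (EuclideanSpace ℝ (Fin n)) := by simpa using hn
  have hnontriv : Nontrivial (EuclideanSpace ℝ (Fin n)) :=
    Module.nontrivial_of_finrank_pos (R := ℝ) (by omega)
  obtain ⟨e, he⟩ := exists_norm_eq (EuclideanSpace ℝ (Fin n)) (zero_le_one (α := ℝ))
  obtain ⟨G, _, _, _, _, _, _, _, _, ρ, hρ⟩ :=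
    exists_isTransitiveOnSpheres (EuclideanSpace ℝ (Fin n))
  obtain ⟨P, _, _, _⟩ := exists_biinvariant_probabilityMeasure G
  have hμ := hf.isProbabilityMeasure_radialMeasure
  set μ := radialMeasure (EuclideanSpace ℝ (Fin n)) finf with hμdef
  have hmap := hf.map_norm_radialMeasure (n := n) (by omega)
  rw [← hμdef] at hmap
  set ν := halfLineMeasure (radialDensity n finf) with hνdef
  have hν : IsProbabilityMeasure ν := by
    rw [← hmap]
    exact Measure.isProbabilityMeasure_map measurable_norm.aemeasurable
  have hpres := hρ.measurePreserving_prod (P := P) hf.measurable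
  rw [← hμdef] at hpres
  have hφc := hφ.continuous
  have hgrad := continuous_gradient hφ
  rw [← hf.integrable_radialMeasure_iff] at hvar
  rw [← hf.integral_radialMeasure, ← hf.integral_radialMeasure φ]
  have hφ1 : Integrable φ μ :=
    ((memLp_two_iff_integrable_sq hφc.aestronglyMeasurable).2 hvar).integrable one_le_two
  -- Averaging over the rotations changes neither integral.
  have hint2 : Integrable (fun p : EuclideanSpace ℝ (Fin n) × _ => φ (ρ p.2 p.1) ^ 2)
      (μ.prod P) := hpres.integrable_comp_of_integrable hvar
  have hint1 : Integrable (fun p : EuclideanSpace ℝ (Fin n) × _ => φ (ρ p.2 p.1))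
      (μ.prod P) := hpres.integrable_comp_of_integrable hφ1
  have havg : ∀ u : EuclideanSpace ℝ (Fin n) → ℝ, Continuous u →
      ∫ x, u x ∂μ = ∫ p, u (ρ p.2 p.1) ∂μ.prod P := fun u hu => by
    have h := integral_map hpres.aemeasurable (f := u) hu.aestronglyMeasurable
    rwa [hpres.map_eq] at h
  have hsq : ∫ x, φ x ^ 2 ∂μ = ∫ x, ∫ g, φ (ρ g x) ^ 2 ∂P ∂μ :=
    (havg (fun x => φ x ^ 2) (hφc.pow 2)).trans (integral_prod _ hint2)
  have hone : ∫ x, φ x ∂μ = ∫ x, ∫ g, φ (ρ g x) ∂P ∂μ :=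
    (havg φ hφc).trans (integral_prod _ hint1)
  set ψ := sphericalMean ρ P e φ with hψdef
  have hψ : ContDiff ℝ ∞ ψ := hρ.contDiff_sphericalMean hφ
  have hmean : ∀ x, ∫ g, φ (ρ g x) ∂P = ψ ‖x‖ := hρ.integral_apply_eq_sphericalMean he
  have hle : ∀ x, ψ ‖x‖ ^ 2 ≤ ∫ g, φ (ρ g x) ^ 2 ∂P := fun x => by
    have hc : Continuous fun g => φ (ρ g x) :=
      hφc.comp (hρ.continuous_apply continuous_id continuous_const)
    rw [← hmean]
    exact sq_integral_le_integral_sq hc.integrable_of_compactSpace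
      (hc.pow 2).integrable_of_compactSpace
  have hA2 : Integrable (fun x => ∫ g, φ (ρ g x) ^ 2 ∂P) μ := hint2.integral_prod_left
  have hψsq : Integrable (fun x => ψ ‖x‖ ^ 2) μ :=
    hA2.mono' ((hψ.continuous.comp continuous_norm).pow 2).aestronglyMeasurable
      (.of_forall fun x => by simpa using hle x)
  have hνψ : ∀ u : ℝ → ℝ, Continuous u → ∫ x, u ‖x‖ ∂μ = ∫ r, u r ∂ν := fun u hu => by
    rw [← hmap, integral_map measurable_norm.aemeasurable hu.aestronglyMeasurable]
  have hψν : Integrable (fun r => ψ r ^ 2) ν := by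
    rw [← hmap]
    exact (integrable_map_measure (hψ.continuous.pow 2).aestronglyMeasurable
      measurable_norm.aemeasurable).2 hψsq
  have h1D := hP.variance_le hf.measurable_radialDensity (fun r hr => hf.radialDensity_nonneg hr)
    hw_meas hw_nonneg hψ hψν
  have hwψ : Measurable fun r => ENNReal.ofReal (w r * deriv ψ r ^ 2) :=
    (hw_meas.mul ((measurable_deriv ψ).pow_const 2)).ennreal_ofReal
  rw [← hνdef, ← hνψ (fun r => ψ r ^ 2) (hψ.continuous.pow 2), ← hνψ ψ hψ.continuous, ← hmap,
    lintegral_map hwψ measurable_norm] at h1D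
  have hW : Measurable (maxWeight w) :=
    hw_meas.max (measurable_const.mul (measurable_id.pow_const 2))
  have hH : Measurable fun x : EuclideanSpace ℝ (Fin n) =>
      ENNReal.ofReal (maxWeight w ‖x‖ * ‖gradient φ x‖ ^ 2) :=
    ((hW.comp measurable_norm).mul (hgrad.norm.measurable.pow_const 2)).ennreal_ofReal
  have hrhs : ∫⁻ x : EuclideanSpace ℝ (Fin n),
        ENNReal.ofReal (maxWeight w ‖x‖ * ‖gradient φ x‖ ^ 2 * finf ‖x‖)
      = ∫⁻ x, ∫⁻ g, ENNReal.ofReal (maxWeight w ‖ρ g x‖ * ‖gradient φ (ρ g x)‖ ^ 2) ∂P ∂μ := by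
    rw [← lintegral_prod (fun p : EuclideanSpace ℝ (Fin n) × _ =>
        ENNReal.ofReal (maxWeight w ‖ρ p.2 p.1‖ * ‖gradient φ (ρ p.2 p.1)‖ ^ 2))
        (hH.comp hpres.measurable).aemeasurable, hpres.lintegral_comp hH, hμdef, radialMeasure,
      lintegral_withDensity_eq_lintegral_mul _ (measurable_ofReal_comp_norm hf.measurable) hH]
    congr 1; ext x
    rw [Pi.mul_apply, ENNReal.ofReal_mul' (hf.nonneg _ (norm_nonneg x)), mul_comm]
  have hae : ∀ᵐ x ∂μ, x ≠ 0 :=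
    (withDensity_absolutelyContinuous _ _).ae_le (Measure.ae_ne volume 0)
  -- The variance of `φ` is the mean of its variance on spheres plus the variance of its mean there.
  calc ENNReal.ofReal (∫ x, φ x ^ 2 ∂μ - (∫ x, φ x ∂μ) ^ 2)
      = ENNReal.ofReal (∫ x, (∫ g, φ (ρ g x) ^ 2 ∂P - ψ ‖x‖ ^ 2) ∂μ
          + (∫ x, ψ ‖x‖ ^ 2 ∂μ - (∫ x, ψ ‖x‖ ∂μ) ^ 2)) := by
        rw [integral_sub hA2 hψsq, hsq, hone]
        simp_rw [hmean]
        congr 1; ring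
    _ ≤ ENNReal.ofReal (∫ x, (∫ g, φ (ρ g x) ^ 2 ∂P - ψ ‖x‖ ^ 2) ∂μ)
          + ENNReal.ofReal (∫ x, ψ ‖x‖ ^ 2 ∂μ - (∫ x, ψ ‖x‖ ∂μ) ^ 2) := ENNReal.ofReal_add_le
    _ ≤ ∫⁻ x, ENNReal.ofReal (∫ g, φ (ρ g x) ^ 2 ∂P - ψ ‖x‖ ^ 2) ∂μ
          + ∫⁻ x, ENNReal.ofReal (w ‖x‖ * deriv ψ ‖x‖ ^ 2) ∂μ := by
        exact add_le_add (ofReal_integral_eq_lintegral_ofReal (hA2.sub hψsq)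
          (.of_forall fun x => sub_nonneg.2 (hle x))).le h1D
    _ = ∫⁻ x, (ENNReal.ofReal (∫ g, φ (ρ g x) ^ 2 ∂P - ψ ‖x‖ ^ 2)
          + ENNReal.ofReal (w ‖x‖ * deriv ψ ‖x‖ ^ 2)) ∂μ :=
        (lintegral_add_right _ (hwψ.comp measurable_norm)).symm
    _ ≤ _ := by
        rw [hrhs]
        refine lintegral_mono_ae (hae.mono fun x hx => ?_)
        rw [← hmean]
        exact variance_orbit_add_deriv_le hρ hE hφ he hw_nonneg hx
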